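/- Let $X$ be a paracompact Hausdorff space and let $n>1$ be an integer. Let $C(X)$ be the algebra of all bounded continuous functions $X\to\mathbb{C}$ with the supremum norm; $C(X)$ is called approximately $n$-th root closed if for every $f\in C(X)$ and every $\varepsilon>0$ there is $g\in C(X)$ with $\|f-g^n\|<\varepsilon$. For a space $A$, let $H^1(A;\mathbb{Z})$ be its first Čech cohomology group with integer coefficients, that is, the direct limit of the groups $H^1(N(\mathcal{U});\mathbb{Z})$ over all open covers $\mathcal{U}$ of $A$ directed by refinement, where $N(\mathcal{U})$ is the nerve of $\mathcal{U}$. An abelian group $H$ is called $n$-divisible if for every $x\in H$ there is $y\in H$ with $ny=x$. Then $C(X)$ is approximately $n$-th root closed if and only if $H^1(A;\mathbb{Z})$ is $n$-divisible for every closed subset $A$ of $X$ (with the subspace topology). -/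

import Mathlib

open scoped BoundedContinuousFunction DirectSum

universe u v

/-- An open cover of `X`: a set of open subsets of `X` whose union is `X`. -/
structure OpenCovering (X : Type u) [TopologicalSpace X] where
  members : Set (Set X)
  isOpen : ∀ U ∈ members, IsOpen U
  sUnion_eq : ⋃₀ members = Set.univ

namespace OpenCovering

variable {X : Type u} [TopologicalSpace X]

/-- The ordered `k`-simplices of the nerve of an open cover: the `(k+1)`-tuples of members of the
cover (repetitions allowed) that have a common point. -/
def Simplex (𝒰 : OpenCovering X) (k : ℕ) : Type u :=
  {σ : Fin (k + 1) → 𝒰.members // (⋂ i, (σ i : Set X)).Nonempty}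

/-- The `j`-th face of an ordered simplex: the `j`-th vertex is omitted. -/
def Simplex.face {𝒰 : OpenCovering X} {k : ℕ} (σ : 𝒰.Simplex (k + 1)) (j : Fin (k + 2)) :
    𝒰.Simplex k :=
  ⟨fun i => σ.1 (j.succAbove i),
    σ.2.mono fun _ hx => Set.mem_iInter.2 fun i => Set.mem_iInter.1 hx (j.succAbove i)⟩

/-- The group of `k`-cochains of the nerve with coefficients in `G`. -/
abbrev Cochain (𝒰 : OpenCovering X) (G : Type v) (k : ℕ) : Type (max u v) :=
  𝒰.Simplex k → G

variable (G : Type v) [AddCommGroup G]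

/-- The coboundary `(δ f)(U₀, …, U_{k+1}) = ∑ⱼ (-1)ʲ f(U₀, …, Ûⱼ, …, U_{k+1})`. -/
def coboundary (𝒰 : OpenCovering X) (k : ℕ) : 𝒰.Cochain G k →+ 𝒰.Cochain G (k + 1) where
  toFun f σ := ∑ j : Fin (k + 2), (-1 : ℤ) ^ (j : ℕ) • f (σ.face j)
  map_zero' := by
    funext σ
    simp
  map_add' f g := by
    funext σ
    simp [smul_add, Finset.sum_add_distrib]

/-- The `k`-cocycles. -/
def cocycles (𝒰 : OpenCovering X) (k : ℕ) : AddSubgroup (𝒰.Cochain G k) :=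
  (𝒰.coboundary G k).ker

/-- The `k`-coboundaries; only `0` in degree `0`. -/
def coboundaries (𝒰 : OpenCovering X) : (k : ℕ) → AddSubgroup (𝒰.Cochain G k)
  | 0 => ⊥
  | k + 1 => (𝒰.coboundary G k).range

/-- The `k`-th simplicial cohomology group of the nerve of the cover `𝒰`:
cocycles modulo coboundaries. -/
abbrev NerveCohomology (𝒰 : OpenCovering X) (k : ℕ) : Type (max u v) :=
  𝒰.cocycles G k ⧸ (𝒰.coboundaries G k).addSubgroupOf (𝒰.cocycles G k)

/-- A refinement map from `𝒱` to `𝒰`: to each member `V` of `𝒱` it assigns a member of `𝒰`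
that contains `V`. Thus `𝒱` refines `𝒰` iff this type is nonempty. -/
structure Refinement (𝒱 𝒰 : OpenCovering X) where
  toFun : 𝒱.members → 𝒰.members
  subset : ∀ V : 𝒱.members, (V : Set X) ⊆ (toFun V : Set X)

namespace Refinement

variable {𝒱 𝒰 : OpenCovering X} (r : Refinement 𝒱 𝒰)

/-- The simplicial map of nerves induced by a refinement map. -/
def mapSimplex {k : ℕ} (σ : 𝒱.Simplex k) : 𝒰.Simplex k :=
  ⟨fun i => r.toFun (σ.1 i),
    σ.2.mono fun _ hx => Set.mem_iInter.2 fun i => r.subset _ (Set.mem_iInter.1 hx i)⟩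

/-- Pullback of cochains along a refinement map. -/
def pullback (k : ℕ) : 𝒰.Cochain G k →+ 𝒱.Cochain G k where
  toFun f σ := f (r.mapSimplex σ)
  map_zero' := rfl
  map_add' _ _ := rfl

theorem coboundary_pullback (k : ℕ) (f : 𝒰.Cochain G k) :
    𝒱.coboundary G k (r.pullback G k f) = r.pullback G (k + 1) (𝒰.coboundary G k f) :=
  rfl

theorem pullback_mem_cocycles (k : ℕ) {f : 𝒰.Cochain G k} (hf : f ∈ 𝒰.cocycles G k) :
    r.pullback G k f ∈ 𝒱.cocycles G k := by
  change 𝒱.coboundary G k (r.pullback G k f) = 0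
  rw [coboundary_pullback, show 𝒰.coboundary G k f = 0 from hf, map_zero]

theorem pullback_mem_coboundaries (k : ℕ) {f : 𝒰.Cochain G k} (hf : f ∈ 𝒰.coboundaries G k) :
    r.pullback G k f ∈ 𝒱.coboundaries G k := by
  cases k with
  | zero =>
    rw [show f = 0 from hf, map_zero]
    exact zero_mem _
  | succ k =>
    obtain ⟨g, rfl⟩ := hf
    exact ⟨r.pullback G k g, r.coboundary_pullback G k g⟩

/-- Pullback of cocycles along a refinement map. -/
def pullbackCocycles (k : ℕ) : 𝒰.cocycles G k →+ 𝒱.cocycles G k :=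
  ((r.pullback G k).comp (𝒰.cocycles G k).subtype).codRestrict (𝒱.cocycles G k)
    fun f => r.pullback_mem_cocycles G k f.2

/-- The map `H^k(nerve 𝒰; G) → H^k(nerve 𝒱; G)` induced by a refinement map from `𝒱` to `𝒰`. -/
def pullbackCohomology (k : ℕ) : 𝒰.NerveCohomology G k →+ 𝒱.NerveCohomology G k :=
  QuotientAddGroup.map _ _ (r.pullbackCocycles G k)
    fun f hf => r.pullback_mem_coboundaries G k (f := f.1) hf

end Refinement

end OpenCovering

open Classical in
/-- The relations of the direct limit: each class on a cover `𝒰` is identified with its pullback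
to each cover `𝒱` that refines `𝒰`, along each refinement map. (Distinct refinement maps from
`𝒱` to `𝒰` are contiguous and so induce the same map in cohomology.) -/
def cechRelations (X : Type u) [TopologicalSpace X] (G : Type v) [AddCommGroup G] (k : ℕ) :
    AddSubgroup (⨁ 𝒰 : OpenCovering X, 𝒰.NerveCohomology G k) :=
  AddSubgroup.closure
    {z | ∃ (𝒰 𝒱 : OpenCovering X) (r : OpenCovering.Refinement 𝒱 𝒰) (c : 𝒰.NerveCohomology G k),
      z = DirectSum.of (fun 𝒲 : OpenCovering X => 𝒲.NerveCohomology G k) 𝒱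
            (r.pullbackCohomology G k c)
        - DirectSum.of (fun 𝒲 : OpenCovering X => 𝒲.NerveCohomology G k) 𝒰 c}

/-- The `k`-th Čech cohomology group `H^k(X; G)`: the direct limit, over all open covers of `X`
directed by refinement, of the cohomology groups of their nerves. -/
abbrev CechCohomology (X : Type u) [TopologicalSpace X] (G : Type v) [AddCommGroup G] (k : ℕ) :
    Type (max u v) :=
  (⨁ 𝒰 : OpenCovering X, 𝒰.NerveCohomology G k) ⧸ cechRelations X G k

/-- An abelian group is `n`-divisible if each of its elements is `n` times an element. -/
def IsNDivisible (n : ℕ) (H : Type v) [AddCommGroup H] : Prop :=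
  ∀ x : H, ∃ y : H, n • y = x

/-- The algebra `C(X)` of bounded continuous complex-valued functions with the supremum norm is
approximately `n`-th root closed. -/
def ApproxRootClosed (n : ℕ) (X : Type u) [TopologicalSpace X] : Prop :=
  ∀ f : X →ᵇ ℂ, ∀ ε : ℝ, 0 < ε → ∃ g : X →ᵇ ℂ, ‖f - g ^ n‖ < ε

/-! On a paracompact Hausdorff space the first integral Čech group is the group of continuous maps
to ℝ/ℤ modulo those that lift to ℝ: a map has local real lifts, and their differences on overlaps
form an integral cocycle (`Represents`). `exists_represents` realises every cocycle by a partition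
of unity, `exists_represents_of_map` gives every map a cocycle, and
`Represents.exists_refinement_coboundary` kills the cocycle of a liftable map on a refinement; hence
`cechToCircle` is bijective.

A liftable map can be divided by `n` through its lift, so by `isNDivisible_cech_iff` divisibility of
the Čech group means that every circle-valued map is an `n`-th multiple.

On a closed `A`, approximate roots of an extended unimodular function do not vanish, and their
phases give exact circle-valued roots. Conversely, exact roots of the phase of `f` where `|f|` is
not small give an `n`-th root of `f` there; a norm-controlled Tietze extension costs little
elsewhere. -/

namespace OpenCovering

/-! ### Low-dimensional simplices of the nerve and common refinements. -/

variable {X : Type u} [TopologicalSpace X] {𝒰 : OpenCovering X}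

theorem exists_mem (𝒰 : OpenCovering X) (x : X) : ∃ U : 𝒰.members, x ∈ (U : Set X) := by
  have hx : x ∈ ⋃₀ 𝒰.members := 𝒰.sUnion_eq ▸ Set.mem_univ x
  obtain ⟨U, hU, hxU⟩ := hx
  exact ⟨⟨U, hU⟩, hxU⟩

/-- The vertex of the nerve given by a nonempty member. -/
def vertex (U : 𝒰.members) (h : (U : Set X).Nonempty) : 𝒰.Simplex 0 :=
  ⟨fun _ => U, h.mono fun _ hx => Set.mem_iInter.2 fun _ => hx⟩

theorem Simplex.eq_vertex (σ : 𝒰.Simplex 0) (h : (σ.1 0 : Set X).Nonempty) :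
    σ = vertex (σ.1 0) h := by
  refine Subtype.ext (funext fun i => ?_)
  fin_cases i
  rfl

/-- The ordered edge of the nerve spanned by two members with a common point. -/
def edge (U V : 𝒰.members) (h : ((U : Set X) ∩ V).Nonempty) : 𝒰.Simplex 1 :=
  ⟨![U, V], h.mono fun _ hx => Set.mem_iInter.2 fun i => by
    fin_cases i
    exacts [hx.1, hx.2]⟩

/-- The ordered triangle of the nerve spanned by three members with a common point. -/
def triangle (U V W : 𝒰.members) (h : ((U : Set X) ∩ V ∩ W).Nonempty) : 𝒰.Simplex 2 :=
  ⟨![U, V, W], h.mono fun _ hx => Set.mem_iInter.2 fun i => by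
    fin_cases i
    exacts [hx.1.1, hx.1.2, hx.2]⟩

theorem Simplex.inter_nonempty (σ : 𝒰.Simplex 1) :
    ((σ.1 0 : Set X) ∩ (σ.1 1)).Nonempty :=
  σ.2.mono fun _ hx => ⟨Set.mem_iInter.1 hx 0, Set.mem_iInter.1 hx 1⟩

theorem Simplex.eq_edge (σ : 𝒰.Simplex 1) : σ = edge (σ.1 0) (σ.1 1) σ.inter_nonempty := by
  refine Subtype.ext (funext fun i => ?_)
  fin_cases i <;> rfl

theorem Refinement.mapSimplex_edge {𝒱 : OpenCovering X} (r : Refinement 𝒱 𝒰)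
    (U V : 𝒱.members) (h : ((U : Set X) ∩ V).Nonempty) :
    r.mapSimplex (edge U V h) = edge (r.toFun U) (r.toFun V)
      (h.mono fun _ hx => ⟨r.subset _ hx.1, r.subset _ hx.2⟩) :=
  Simplex.eq_edge _

section Group

variable {G : Type v} [AddCommGroup G]

theorem coboundary_zero_edge (b : 𝒰.Cochain G 0) {U V : 𝒰.members} {x : X}
    (hU : x ∈ (U : Set X)) (hV : x ∈ (V : Set X)) :
    𝒰.coboundary G 0 b (edge U V ⟨x, hU, hV⟩) = b (vertex V ⟨x, hV⟩) - b (vertex U ⟨x, hU⟩) := by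
  change ∑ j : Fin 2, (-1 : ℤ) ^ (j : ℕ) • b ((edge U V ⟨x, hU, hV⟩).face j) = _
  have h0 : (edge U V ⟨x, hU, hV⟩).face 0 = vertex V ⟨x, hV⟩ := Simplex.eq_vertex _ _
  have h1 : (edge U V ⟨x, hU, hV⟩).face 1 = vertex U ⟨x, hU⟩ := Simplex.eq_vertex _ _
  rw [Fin.sum_univ_two, h0, h1]
  simp [sub_eq_add_neg]

theorem edge_add_edge {c : 𝒰.Cochain G 1} (hc : c ∈ 𝒰.cocycles G 1) {U V W : 𝒰.members} {x : X}
    (hU : x ∈ (U : Set X)) (hV : x ∈ (V : Set X)) (hW : x ∈ (W : Set X)) :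
    c (edge U V ⟨x, hU, hV⟩) + c (edge V W ⟨x, hV, hW⟩) = c (edge U W ⟨x, hU, hW⟩) := by
  have h : ∑ j : Fin 3, (-1 : ℤ) ^ (j : ℕ) • c ((triangle U V W ⟨x, ⟨hU, hV⟩, hW⟩).face j) = 0 :=
    congrFun (show 𝒰.coboundary G 1 c = 0 from hc) (triangle U V W ⟨x, ⟨hU, hV⟩, hW⟩)
  have h0 : (triangle U V W ⟨x, ⟨hU, hV⟩, hW⟩).face 0 = edge V W ⟨x, hV, hW⟩ := Simplex.eq_edge _
  have h1 : (triangle U V W ⟨x, ⟨hU, hV⟩, hW⟩).face 1 = edge U W ⟨x, hU, hW⟩ := Simplex.eq_edge _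
  have h2 : (triangle U V W ⟨x, ⟨hU, hV⟩, hW⟩).face 2 = edge U V ⟨x, hU, hV⟩ := Simplex.eq_edge _
  rw [Fin.sum_univ_three, h0, h1, h2] at h
  simp only [Fin.val_zero, pow_zero, one_smul, Fin.val_one, pow_one, neg_smul, Fin.val_two,
    even_two, Even.neg_pow, one_pow] at h
  rw [← sub_eq_zero, ← h]
  abel

theorem mem_cocycles_of_edge {c : 𝒰.Cochain G 1}
    (hc : ∀ (U V W : 𝒰.members) (x : X) (hU : x ∈ (U : Set X)) (hV : x ∈ (V : Set X))
      (hW : x ∈ (W : Set X)),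
      c (edge U V ⟨x, hU, hV⟩) + c (edge V W ⟨x, hV, hW⟩) = c (edge U W ⟨x, hU, hW⟩)) :
    c ∈ 𝒰.cocycles G 1 := by
  refine funext fun σ => ?_
  obtain ⟨x, hx⟩ := σ.2
  have hx := Set.mem_iInter.1 hx
  change ∑ j : Fin 3, (-1 : ℤ) ^ (j : ℕ) • c (σ.face j) = 0
  have h0 : σ.face 0 = edge (σ.1 1) (σ.1 2) ⟨x, hx 1, hx 2⟩ := Simplex.eq_edge _
  have h1 : σ.face 1 = edge (σ.1 0) (σ.1 2) ⟨x, hx 0, hx 2⟩ := Simplex.eq_edge _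
  have h2 : σ.face 2 = edge (σ.1 0) (σ.1 1) ⟨x, hx 0, hx 1⟩ := Simplex.eq_edge _
  rw [Fin.sum_univ_three, h0, h1, h2, ← hc _ _ _ x (hx 0) (hx 1) (hx 2)]
  simp

theorem exists_common_refinement (𝒰 𝒱 : OpenCovering X) :
    ∃ 𝒲 : OpenCovering X, Nonempty (Refinement 𝒲 𝒰) ∧ Nonempty (Refinement 𝒲 𝒱) := by
  refine ⟨⟨{W | ∃ (U : 𝒰.members) (V : 𝒱.members), W = (U : Set X) ∩ V}, ?_, ?_⟩, ⟨?_⟩, ⟨?_⟩⟩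
  · rintro _ ⟨U, V, rfl⟩
    exact (𝒰.isOpen _ U.2).inter (𝒱.isOpen _ V.2)
  · refine Set.eq_univ_of_forall fun x => ?_
    obtain ⟨U, hU⟩ := 𝒰.exists_mem x
    obtain ⟨V, hV⟩ := 𝒱.exists_mem x
    exact ⟨_, ⟨U, V, rfl⟩, hU, hV⟩
  · choose p q h using fun W : {W | ∃ (U : 𝒰.members) (V : 𝒱.members), W = (U : Set X) ∩ V} => W.2
    exact ⟨p, fun W => (h W).trans_subset Set.inter_subset_left⟩
  · choose p q h using fun W : {W | ∃ (U : 𝒰.members) (V : 𝒱.members), W = (U : Set X) ∩ V} => W.2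
    exact ⟨q, fun W => (h W).trans_subset Set.inter_subset_right⟩

end Group

/-! ### Integral 1-cocycles and circle-valued maps. -/

/-- A circle-valued map represents an integral `1`-cochain if it has lifts to `ℝ` on the members of
the cover that differ on the overlaps by the values of the cochain. -/
def Represents (𝒰 : OpenCovering X) (f : C(X, UnitAddCircle)) (c : 𝒰.Cochain ℤ 1) : Prop :=
  ∃ t : 𝒰.members → X → ℝ, (∀ U : 𝒰.members, ContinuousOn (t U) U) ∧
    (∀ U : 𝒰.members, ∀ x ∈ (U : Set X), (t U x : UnitAddCircle) = f x) ∧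
    ∀ (U V : 𝒰.members) (x : X) (hU : x ∈ (U : Set X)) (hV : x ∈ (V : Set X)),
      t V x - t U x = c (edge U V ⟨x, hU, hV⟩)

/-- The circle-valued maps that lift to `ℝ`. -/
def liftable (X : Type u) [TopologicalSpace X] : AddSubgroup C(X, UnitAddCircle) where
  carrier := {f | ∃ h : C(X, ℝ), ∀ x, f x = (h x : UnitAddCircle)}
  zero_mem' := ⟨0, fun x => by simp⟩
  add_mem' := by
    rintro f g ⟨h, hf⟩ ⟨k, hg⟩
    exact ⟨h + k, fun x => by simp [hf, hg]⟩
  neg_mem' := by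
    rintro f ⟨h, hf⟩
    exact ⟨-h, fun x => by simp [hf]⟩

theorem continuous_of_eqOn_members {Y : Type*} [TopologicalSpace Y] (t : 𝒰.members → X → Y)
    (ht : ∀ U : 𝒰.members, ContinuousOn (t U) U) {f : X → Y}
    (hf : ∀ U : 𝒰.members, ∀ x ∈ (U : Set X), t U x = f x) : Continuous f := by
  refine continuous_iff_continuousAt.2 fun x => ?_
  obtain ⟨U, hU⟩ := 𝒰.exists_mem x
  have hn := (𝒰.isOpen _ U.2).mem_nhds hU
  exact ((ht U).continuousAt hn).congr (Filter.mem_of_superset hn fun y hy => hf U y hy)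

theorem exists_glue {Y : Type*} [TopologicalSpace Y] (t : 𝒰.members → X → Y)
    (ht : ∀ U : 𝒰.members, ContinuousOn (t U) U)
    (h : ∀ (U V : 𝒰.members) (x : X), x ∈ (U : Set X) → x ∈ (V : Set X) → t U x = t V x) :
    ∃ f : C(X, Y), ∀ U : 𝒰.members, ∀ x ∈ (U : Set X), t U x = f x := by
  choose m hm using 𝒰.exists_mem
  exact ⟨⟨fun x => t (m x) x, continuous_of_eqOn_members t ht fun U x hx => h _ _ x hx (hm x)⟩,
    fun U x hx => h _ _ x hx (hm x)⟩

theorem Represents.add {f g : C(X, UnitAddCircle)} {c d : 𝒰.Cochain ℤ 1}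
    (hf : 𝒰.Represents f c) (hg : 𝒰.Represents g d) : 𝒰.Represents (f + g) (c + d) := by
  obtain ⟨t, ht, hft, htc⟩ := hf
  obtain ⟨s, hs, hgs, hsd⟩ := hg
  refine ⟨fun U => t U + s U, fun U => (ht U).add (hs U), fun U x hx => ?_,
    fun U V x hU hV => ?_⟩
  · simp [hft U x hx, hgs U x hx]
  · have h1 := htc U V x hU hV
    have h2 := hsd U V x hU hV
    simp only [Pi.add_apply, Int.cast_add]
    linarith

theorem Represents.neg {f : C(X, UnitAddCircle)} {c : 𝒰.Cochain ℤ 1}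
    (hf : 𝒰.Represents f c) : 𝒰.Represents (-f) (-c) := by
  obtain ⟨t, ht, hft, htc⟩ := hf
  refine ⟨fun U => -t U, fun U => (ht U).neg, fun U x hx => ?_, fun U V x hU hV => ?_⟩
  · simp [hft U x hx]
  · have h1 := htc U V x hU hV
    simp only [Pi.neg_apply, Int.cast_neg]
    linarith

theorem Represents.pullback {𝒱 : OpenCovering X} (r : Refinement 𝒱 𝒰) {f : C(X, UnitAddCircle)}
    {c : 𝒰.Cochain ℤ 1} (hf : 𝒰.Represents f c) : 𝒱.Represents f (r.pullback ℤ 1 c) := by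
  obtain ⟨t, ht, hft, htc⟩ := hf
  refine ⟨fun V => t (r.toFun V), fun V => (ht _).mono (r.subset V),
    fun V x hx => hft _ x (r.subset V hx), fun U V x hU hV => ?_⟩
  refine (htc _ _ x (r.subset U hU) (r.subset V hV)).trans ?_
  exact congrArg (fun σ => ((c σ : ℤ) : ℝ)) (r.mapSimplex_edge U V ⟨x, hU, hV⟩).symm

/-- The integers `b U`, taken as constant functions on the members, are lifts of the zero map. -/
theorem represents_zero_coboundary (b : 𝒰.Cochain ℤ 0) :
    𝒰.Represents 0 (𝒰.coboundary ℤ 0 b) := by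
  classical
  let t : 𝒰.members → ℤ := fun U => if h : (U : Set X).Nonempty then b (vertex U h) else 0
  have ht : ∀ (U : 𝒰.members) (h : (U : Set X).Nonempty), t U = b (vertex U h) :=
    fun U h => dif_pos h
  refine ⟨fun U _ => t U, fun U => continuousOn_const,
    fun U x hx => (AddCircle.coe_eq_zero_iff 1).2 ⟨t U, by simp⟩, fun U V x hU hV => ?_⟩
  change (t V : ℝ) - t U = _
  rw [ht U ⟨x, hU⟩, ht V ⟨x, hV⟩, ← Int.cast_sub]
  exact congrArg _ (coboundary_zero_edge b hU hV).symm

theorem Represents.mem_liftable_of_zero {f : C(X, UnitAddCircle)} (hf : 𝒰.Represents f 0) :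
    f ∈ liftable X := by
  obtain ⟨t, ht, hft, htc⟩ := hf
  obtain ⟨h, hh⟩ := exists_glue t ht fun U V x hU hV => by
    have := htc U V x hU hV
    simp only [Pi.zero_apply, Int.cast_zero] at this
    linarith
  refine ⟨h, fun x => ?_⟩
  obtain ⟨U, hU⟩ := 𝒰.exists_mem x
  rw [← hh U x hU, hft U x hU]

theorem Represents.sub_mem_liftable {f g : C(X, UnitAddCircle)} {c : 𝒰.Cochain ℤ 1}
    (hf : 𝒰.Represents f c) (hg : 𝒰.Represents g c) : f - g ∈ liftable X := by
  have h := hf.add hg.neg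
  rw [add_neg_cancel, ← sub_eq_add_neg] at h
  exact h.mem_liftable_of_zero

/-- Over ℝ the cocycle is a coboundary of continuous functions: with a subordinate partition of
unity put `t U = ∑ φ W • c (W, U)`. The cocycle identity gives `t V - t U = c (U, V)`, an integer,
so the `t U` agree modulo ℤ and glue. -/
theorem exists_represents [T2Space X] [ParacompactSpace X] {c : 𝒰.Cochain ℤ 1}
    (hc : c ∈ 𝒰.cocycles ℤ 1) : ∃ f, 𝒰.Represents f c := by
  classical
  obtain ⟨φ, hφ⟩ := PartitionOfUnity.exists_isSubordinate (isClosed_univ (X := X))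
    (fun U : 𝒰.members => (U : Set X)) (fun U => 𝒰.isOpen _ U.2)
    (fun x _ => Set.mem_iUnion.2 (𝒰.exists_mem x))
  -- The default `0` is never felt at a point of `U`: there `φ W x ≠ 0` forces `W` to meet `U`.
  let e : 𝒰.members → 𝒰.members → ℝ := fun W U =>
    if h : ((W : Set X) ∩ U).Nonempty then ((c (edge W U h) : ℤ) : ℝ) else 0
  let t : 𝒰.members → X → ℝ := fun U x => ∑ᶠ W, φ W x • e W U
  have ht : ∀ U, Continuous (t U) := fun U =>
    φ.continuous_finsum_smul fun _ _ _ => continuousAt_const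
  have hfin : ∀ (U : 𝒰.members) x, (Function.support fun W => φ W x • e W U).Finite := by
    refine fun U x => (φ.locallyFinite.point_finite x).subset fun W hW hW' => hW ?_
    have : φ W x = 0 := by simpa using hW'
    simp [this]
  have htc : ∀ (U V : 𝒰.members) (x : X) (hU : x ∈ (U : Set X)) (hV : x ∈ (V : Set X)),
      t V x - t U x = c (edge U V ⟨x, hU, hV⟩) := by
    intro U V x hU hV
    rw [← finsum_sub_distrib (hfin V x) (hfin U x)]
    have : ∀ W, φ W x • e W V - φ W x • e W U = φ W x * c (edge U V ⟨x, hU, hV⟩) := by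
      intro W
      by_cases h0 : φ W x = 0
      · simp [h0]
      have hW : x ∈ (W : Set X) := hφ W (subset_tsupport _ h0)
      simp only [e]
      rw [dif_pos ⟨x, hW, hV⟩, dif_pos ⟨x, hW, hU⟩, ← edge_add_edge hc hW hU hV]
      push_cast
      simp only [smul_eq_mul]
      ring
    rw [finsum_congr this, ← finsum_mul, φ.sum_eq_one (Set.mem_univ x), one_mul]
  obtain ⟨f, hf⟩ := exists_glue (𝒰 := 𝒰) (fun U x => (t U x : UnitAddCircle))
    (fun U => ((AddCircle.continuous_mk' 1).comp (ht U)).continuousOn) fun U V x hU hV => by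
      rw [eq_comm, ← sub_eq_zero, ← AddCircle.coe_sub, htc U V x hU hV]
      exact (AddCircle.coe_eq_zero_iff 1).2 ⟨c (edge U V ⟨x, hU, hV⟩), by simp⟩
  exact ⟨f, t, fun U => (ht U).continuousOn, hf, htc⟩

/-- Subtracting a global lift `h` from the local lifts leaves continuous integer-valued functions.
Their level sets refine the cover, and on the refinement the levels form a 0-cochain whose
coboundary is the pullback of `c`. -/
theorem Represents.exists_refinement_coboundary {f : C(X, UnitAddCircle)} {c : 𝒰.Cochain ℤ 1}
    (hf : 𝒰.Represents f c) (hl : f ∈ liftable X) :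
    ∃ (𝒱 : OpenCovering X) (r : Refinement 𝒱 𝒰),
      r.pullback ℤ 1 c ∈ 𝒱.coboundaries ℤ 1 := by
  obtain ⟨t, ht, hft, htc⟩ := hf
  obtain ⟨h, hh⟩ := hl
  have hint : ∀ (U : 𝒰.members) (x : X), x ∈ (U : Set X) → ∃ k : ℤ, (k : ℝ) = t U x - h x := by
    intro U x hx
    have h0 : ((t U x - h x : ℝ) : UnitAddCircle) = 0 := by
      rw [AddCircle.coe_sub, hft U x hx, hh, sub_self]
    obtain ⟨k, hk⟩ := (AddCircle.coe_eq_zero_iff 1).1 h0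
    exact ⟨k, by simpa using hk⟩
  -- An open interval of radius 1/2 contains only the integer `k`, so this level set is open.
  let S : 𝒰.members → ℤ → Set X := fun U k =>
    (U : Set X) ∩ (fun x => t U x - h x) ⁻¹' Set.Ioo (k - 1 / 2 : ℝ) (k + 1 / 2)
  have hS : ∀ U k, ∀ x ∈ S U k, t U x - h x = k := by
    rintro U k x ⟨hU, h1, h2⟩
    obtain ⟨m, hm⟩ := hint U x hU
    replace h1 : (k : ℝ) - 1 / 2 < t U x - h x := h1
    replace h2 : t U x - h x < (k : ℝ) + 1 / 2 := h2
    rw [← hm] at h1 h2 ⊢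
    have h3 : (k : ℝ) < m + 1 := by linarith
    have h4 : (m : ℝ) < k + 1 := by linarith
    norm_cast at h3 h4 ⊢
    omega
  let M : Set (Set X) := {V | ∃ U k, V = S U k}
  have hM : ⋃₀ M = Set.univ := by
    refine Set.eq_univ_of_forall fun x => ?_
    obtain ⟨U, hU⟩ := 𝒰.exists_mem x
    obtain ⟨k, hk⟩ := hint U x hU
    refine ⟨_, ⟨U, k, rfl⟩, hU, ?_⟩
    simp only [Set.mem_preimage, ← hk]
    constructor <;> linarith
  let 𝒱 : OpenCovering X := ⟨M, by
    rintro _ ⟨U, k, rfl⟩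
    exact ((ht U).sub h.continuous.continuousOn).isOpen_inter_preimage (𝒰.isOpen _ U.2) isOpen_Ioo,
    hM⟩
  choose p k hp using fun V : 𝒱.members => V.2
  let r : Refinement 𝒱 𝒰 := ⟨p, fun V => (hp V).trans_subset Set.inter_subset_left⟩
  let b : 𝒱.Cochain ℤ 0 := fun σ => k (σ.1 0)
  refine ⟨𝒱, r, b, funext fun σ => ?_⟩
  rw [σ.eq_edge]
  obtain ⟨x, hx0, hx1⟩ := σ.inter_nonempty
  refine (coboundary_zero_edge b hx0 hx1).trans ?_
  refine Eq.trans ?_ (congrArg c (r.mapSimplex_edge _ _ ⟨x, hx0, hx1⟩)).symm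
  have h0 := hS _ _ x (hp (σ.1 0) ▸ hx0)
  have h1 := hS _ _ x (hp (σ.1 1) ▸ hx1)
  have h2 := htc _ _ x (r.subset _ hx0) (r.subset _ hx1)
  have h3 : (k (σ.1 1) - k (σ.1 0) : ℝ) = t (p (σ.1 1)) x - t (p (σ.1 0)) x := by linarith
  rw [← Int.cast_sub] at h3
  exact Int.cast_injective (h3.trans h2)

/-- The cover consists of open sets on which `f` has a lift with values in an interval of length
1/2. The difference of two such lifts on an overlap is an integer confined to an open interval of
length 1, hence constant even if the overlap is disconnected. -/
theorem exists_represents_of_map (f : C(X, UnitAddCircle)) :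
    ∃ (𝒰 : OpenCovering X) (c : 𝒰.Cochain ℤ 1), c ∈ 𝒰.cocycles ℤ 1 ∧ 𝒰.Represents f c := by
  classical
  let M : Set (Set X) := {U | IsOpen U ∧ ∃ (s : ℝ) (t : X → ℝ), ContinuousOn t U ∧
    ∀ x ∈ U, t x ∈ Set.Ioo (s - 1 / 4) (s + 1 / 4) ∧ (t x : UnitAddCircle) = f x}
  have hM : ⋃₀ M = Set.univ := by
    refine Set.eq_univ_of_forall fun x => ?_
    obtain ⟨s, hs⟩ := QuotientAddGroup.mk_surjective (f x)
    let e := AddCircle.openPartialHomeomorphCoe (1 : ℝ) (s - 1 / 2)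
    have hsub : Set.Ioo (s - 1 / 4) (s + 1 / 4) ⊆ e.source := by
      intro y hy
      change y ∈ Set.Ioo (s - 1 / 2) (s - 1 / 2 + 1)
      constructor <;> linarith [hy.1, hy.2]
    have hmem : ∀ y ∈ e '' Set.Ioo (s - 1 / 4) (s + 1 / 4),
        e.symm y ∈ Set.Ioo (s - 1 / 4) (s + 1 / 4) ∧ e (e.symm y) = y := by
      rintro _ ⟨y, hy, rfl⟩
      rw [e.left_inv (hsub hy)]
      exact ⟨hy, rfl⟩
    have htar : e '' Set.Ioo (s - 1 / 4) (s + 1 / 4) ⊆ e.target := by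
      rintro _ ⟨y, hy, rfl⟩
      exact e.map_source (hsub hy)
    refine ⟨f ⁻¹' (e '' Set.Ioo (s - 1 / 4) (s + 1 / 4)),
      ⟨(e.isOpen_image_of_subset_source isOpen_Ioo hsub).preimage f.continuous, s,
        fun y => e.symm (f y), ?_, fun y hy => hmem _ hy⟩,
      s, ⟨by linarith, by linarith⟩, hs⟩
    exact e.continuousOn_symm.comp f.continuous.continuousOn fun y hy => htar hy
  let 𝒰 : OpenCovering X := ⟨M, fun U hU => hU.1, hM⟩
  choose s t ht hst using fun U : 𝒰.members => U.2.2
  have hdiff : ∀ (U V : 𝒰.members) (x y : X), x ∈ (U : Set X) → x ∈ (V : Set X) →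
      y ∈ (U : Set X) → y ∈ (V : Set X) →
      ∃ k : ℤ, t V x - t U x = k ∧ t V y - t U y = k := by
    have hint : ∀ (U V : 𝒰.members) (x : X), x ∈ (U : Set X) → x ∈ (V : Set X) →
        ∃ k : ℤ, t V x - t U x = k := by
      intro U V x hU hV
      have h0 : ((t V x - t U x : ℝ) : UnitAddCircle) = 0 := by
        rw [AddCircle.coe_sub, (hst U x hU).2, (hst V x hV).2, sub_self]
      obtain ⟨k, hk⟩ := (AddCircle.coe_eq_zero_iff 1).1 h0
      exact ⟨k, by simpa using hk.symm⟩
    intro U V x y hxU hxV hyU hyV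
    obtain ⟨k, hk⟩ := hint U V x hxU hxV
    obtain ⟨m, hm⟩ := hint U V y hyU hyV
    obtain ⟨⟨a1, a2⟩, -⟩ := hst U x hxU
    obtain ⟨⟨b1, b2⟩, -⟩ := hst V x hxV
    obtain ⟨⟨c1, c2⟩, -⟩ := hst U y hyU
    obtain ⟨⟨d1, d2⟩, -⟩ := hst V y hyV
    have h1 : (k : ℝ) < m + 1 := by linarith
    have h2 : (m : ℝ) < k + 1 := by linarith
    norm_cast at h1 h2
    obtain rfl : k = m := by omega
    exact ⟨k, hk, hm⟩
  -- The difference is an integer independent of the point, so any point of the overlap will do and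
  -- `round` only reads the integer off.
  let c : 𝒰.Cochain ℤ 1 := fun σ =>
    round (t (σ.1 1) σ.inter_nonempty.some - t (σ.1 0) σ.inter_nonempty.some)
  have hc : ∀ (U V : 𝒰.members) (x : X) (hU : x ∈ (U : Set X)) (hV : x ∈ (V : Set X)),
      t V x - t U x = c (edge U V ⟨x, hU, hV⟩) := by
    intro U V x hU hV
    have hz := (edge U V ⟨x, hU, hV⟩).inter_nonempty.some_mem
    obtain ⟨k, hk, hk'⟩ := hdiff U V x _ hU hV hz.1 hz.2
    rw [hk]
    change (k : ℝ) = (round (t V _ - t U _) : ℤ)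
    rw [hk', round_intCast]
  refine ⟨𝒰, c, mem_cocycles_of_edge fun U V W x hU hV hW => ?_, t, ht,
    fun U x hx => (hst U x hx).2, hc⟩
  have h1 := hc U V x hU hV
  have h2 := hc V W x hV hW
  have h3 := hc U W x hU hW
  have h4 : ((c (edge U V ⟨x, hU, hV⟩) + c (edge V W ⟨x, hV, hW⟩) : ℤ) : ℝ) =
      c (edge U W ⟨x, hU, hW⟩) := by
    push_cast
    linarith
  exact_mod_cast h4

end OpenCovering

/-- The class of `h / n` is an exact `n`-th part of `f - n • g`; adding it to `g` corrects the
error. -/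
theorem exists_nsmul_eq_of_lift {Y : Type*} [TopologicalSpace Y] {n : ℕ} (hn : n ≠ 0)
    {f g : C(Y, UnitAddCircle)} {h : C(Y, ℝ)}
    (hh : ∀ y, (f - n • g) y = (h y : UnitAddCircle)) : ∃ k, n • k = f := by
  let m : C(Y, UnitAddCircle) :=
    ⟨fun y => ((h y / n : ℝ) : UnitAddCircle),
      (AddCircle.continuous_mk' 1).comp (h.continuous.div_const _)⟩
  have hm : n • m = f - n • g := ContinuousMap.ext fun y => by
    rw [hh]
    change n • ((h y / n : ℝ) : UnitAddCircle) = _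
    rw [← AddCircle.coe_nsmul, nsmul_eq_mul, mul_div_cancel₀ _ (Nat.cast_ne_zero.2 hn)]
  exact ⟨g + m, by rw [smul_add, hm]; abel⟩

/-! ### The first Čech group as circle-valued maps modulo liftable ones. -/

section Cech

variable {X : Type u} [TopologicalSpace X]

open Classical in
/-- The class in Čech cohomology of a class on a cover. -/
noncomputable def cechClass (𝒰 : OpenCovering X) (G : Type v) [AddCommGroup G] (k : ℕ) :
    𝒰.NerveCohomology G k →+ CechCohomology X G k :=
  (QuotientAddGroup.mk' (cechRelations X G k)).comp
    (DirectSum.of (fun 𝒲 : OpenCovering X => 𝒲.NerveCohomology G k) 𝒰)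

theorem cechClass_pullback {G : Type v} [AddCommGroup G] {k : ℕ} {𝒰 𝒱 : OpenCovering X}
    (r : OpenCovering.Refinement 𝒱 𝒰) (c : 𝒰.NerveCohomology G k) :
    cechClass 𝒱 G k (r.pullbackCohomology G k c) = cechClass 𝒰 G k c :=
  (QuotientAddGroup.eq_iff_sub_mem).2 (AddSubgroup.subset_closure ⟨𝒰, 𝒱, r, c, rfl⟩)

/-- Covers are directed by refinement, so a finite sum of classes can be moved to one cover. -/
theorem exists_cechClass_eq {G : Type v} [AddCommGroup G] {k : ℕ} (y : CechCohomology X G k) :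
    ∃ (𝒰 : OpenCovering X) (c : 𝒰.cocycles G k),
      cechClass 𝒰 G k (QuotientAddGroup.mk c) = y := by
  classical
  suffices h : ∃ (𝒰 : OpenCovering X) (c : 𝒰.NerveCohomology G k), cechClass 𝒰 G k c = y by
    obtain ⟨𝒰, c, rfl⟩ := h
    obtain ⟨c, rfl⟩ := QuotientAddGroup.mk_surjective c
    exact ⟨𝒰, c, rfl⟩
  obtain ⟨z, rfl⟩ := QuotientAddGroup.mk_surjective y
  induction z using DirectSum.induction_on with
  | zero =>
    exact ⟨⟨{Set.univ}, fun U hU => hU ▸ isOpen_univ, Set.sUnion_singleton _⟩, 0, map_zero _⟩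
  | of 𝒰 c => exact ⟨𝒰, c, by simp only [cechClass]; congr⟩
  | add a b ha hb =>
    obtain ⟨𝒰, c, hc⟩ := ha
    obtain ⟨𝒱, d, hd⟩ := hb
    obtain ⟨𝒲, ⟨r⟩, ⟨s⟩⟩ := 𝒰.exists_common_refinement 𝒱
    refine ⟨𝒲, r.pullbackCohomology G k c + s.pullbackCohomology G k d, ?_⟩
    rw [map_add, cechClass_pullback, cechClass_pullback, hc, hd]
    rfl

variable [T2Space X] [ParacompactSpace X]

/-- The class, modulo liftable maps, of the circle-valued maps that represent a `1`-cocycle. -/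
noncomputable def cocycleToCircle (𝒰 : OpenCovering X) :
    𝒰.cocycles ℤ 1 →+ C(X, UnitAddCircle) ⧸ OpenCovering.liftable X :=
  AddMonoidHom.mk' (fun c => QuotientAddGroup.mk (OpenCovering.exists_represents c.2).choose)
    fun c d => by
      rw [← QuotientAddGroup.mk_add, QuotientAddGroup.eq_iff_sub_mem]
      exact (OpenCovering.exists_represents (c + d).2).choose_spec.sub_mem_liftable
        ((OpenCovering.exists_represents c.2).choose_spec.add
          (OpenCovering.exists_represents d.2).choose_spec)

theorem cocycleToCircle_eq {𝒰 : OpenCovering X} {c : 𝒰.cocycles ℤ 1} {f : C(X, UnitAddCircle)}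
    (h : 𝒰.Represents f c) : cocycleToCircle 𝒰 c = QuotientAddGroup.mk f :=
  QuotientAddGroup.eq_iff_sub_mem.2
    ((OpenCovering.exists_represents c.2).choose_spec.sub_mem_liftable h)

/-- The map from the cohomology of a nerve to the circle-valued maps modulo liftable maps. -/
noncomputable def nerveToCircle (𝒰 : OpenCovering X) :
    𝒰.NerveCohomology ℤ 1 →+ C(X, UnitAddCircle) ⧸ OpenCovering.liftable X :=
  QuotientAddGroup.lift _ (cocycleToCircle 𝒰) fun c hc => by
    obtain ⟨b, hb⟩ := hc
    have h := OpenCovering.represents_zero_coboundary b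
    rw [show 𝒰.coboundary ℤ 0 b = c.1 from hb] at h
    exact cocycleToCircle_eq h

open Classical in
/-- The comparison map from the first integral Čech cohomology group to the circle-valued maps
modulo the liftable ones. -/
noncomputable def cechToCircle (X : Type u) [TopologicalSpace X] [T2Space X] [ParacompactSpace X] :
    CechCohomology X ℤ 1 →+ C(X, UnitAddCircle) ⧸ OpenCovering.liftable X :=
  QuotientAddGroup.lift _ (DirectSum.toAddMonoid nerveToCircle) <| by
    refine (AddSubgroup.closure_le _).2 ?_
    rintro _ ⟨𝒰, 𝒱, r, c, rfl⟩
    obtain ⟨c, rfl⟩ := QuotientAddGroup.mk_surjective c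
    obtain ⟨f, hf⟩ := OpenCovering.exists_represents c.2
    rw [SetLike.mem_coe, AddMonoidHom.mem_ker, map_sub, DirectSum.toAddMonoid_of,
      DirectSum.toAddMonoid_of, sub_eq_zero]
    exact (cocycleToCircle_eq (c := r.pullbackCocycles ℤ 1 c) (hf.pullback r)).trans
      (cocycleToCircle_eq hf).symm

theorem cechToCircle_cechClass {𝒰 : OpenCovering X} {c : 𝒰.cocycles ℤ 1}
    {f : C(X, UnitAddCircle)} (h : 𝒰.Represents f c) :
    cechToCircle X (cechClass 𝒰 ℤ 1 (QuotientAddGroup.mk c)) = QuotientAddGroup.mk f := by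
  classical
  refine Eq.trans ?_ (cocycleToCircle_eq h)
  exact DirectSum.toAddMonoid_of nerveToCircle 𝒰 (QuotientAddGroup.mk c)

theorem cechToCircle_surjective : Function.Surjective (cechToCircle X) := by
  intro q
  obtain ⟨f, rfl⟩ := QuotientAddGroup.mk_surjective q
  obtain ⟨𝒰, c, hc, h⟩ := OpenCovering.exists_represents_of_map f
  exact ⟨_, cechToCircle_cechClass (c := ⟨c, hc⟩) h⟩

theorem cechToCircle_injective : Function.Injective (cechToCircle X) := by
  refine (injective_iff_map_eq_zero _).2 fun y hy => ?_
  obtain ⟨𝒰, c, rfl⟩ := exists_cechClass_eq y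
  obtain ⟨f, hf⟩ := OpenCovering.exists_represents c.2
  rw [cechToCircle_cechClass hf, QuotientAddGroup.eq_zero_iff] at hy
  obtain ⟨𝒱, r, hr⟩ := hf.exists_refinement_coboundary hy
  have h0 : r.pullbackCohomology ℤ 1 (QuotientAddGroup.mk c) = 0 :=
    (QuotientAddGroup.eq_zero_iff (r.pullbackCocycles ℤ 1 c)).2 hr
  rw [← cechClass_pullback r, h0, map_zero]

theorem isNDivisible_cech_iff {n : ℕ} (hn : n ≠ 0) :
    IsNDivisible n (CechCohomology X ℤ 1) ↔ ∀ f : C(X, UnitAddCircle), ∃ g, n • g = f := by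
  constructor
  · intro h f
    obtain ⟨x, hx⟩ := cechToCircle_surjective (X := X) (QuotientAddGroup.mk f)
    obtain ⟨y, rfl⟩ := h x
    obtain ⟨g, hg⟩ := QuotientAddGroup.mk_surjective (cechToCircle X y)
    rw [map_nsmul, ← hg, ← QuotientAddGroup.mk_nsmul, eq_comm,
      QuotientAddGroup.eq_iff_sub_mem] at hx
    obtain ⟨k, hk⟩ := hx
    exact exists_nsmul_eq_of_lift hn hk
  · intro h x
    obtain ⟨f, hf⟩ := QuotientAddGroup.mk_surjective (cechToCircle X x)
    obtain ⟨g, rfl⟩ := h f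
    obtain ⟨y, hy⟩ := cechToCircle_surjective (X := X) (QuotientAddGroup.mk g)
    refine ⟨y, cechToCircle_injective ?_⟩
    rw [map_nsmul, hy, ← hf, QuotientAddGroup.mk_nsmul]

end Cech

/-! ### Approximate roots of functions and exact roots of circle-valued maps. -/

section Roots

theorem exists_polar {Y : Type*} [TopologicalSpace Y] (f : C(Y, ℂ)) (hf : ∀ y, f y ≠ 0) :
    ∃ θ : C(Y, UnitAddCircle), ∀ y, f y = ‖f y‖ * ((θ y).toCircle : ℂ) := by
  let u : C(Y, Circle) := ⟨fun y => ⟨f y / ‖f y‖, mem_sphere_zero_iff_norm.2 (by simp [hf y])⟩,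
    Continuous.subtype_mk (f.continuous.div (by fun_prop) fun y => by simpa using hf y) _⟩
  let e := AddCircle.homeomorphCircle (one_ne_zero (α := ℝ))
  refine ⟨⟨fun y => e.symm (u y), e.symm.continuous.comp u.continuous⟩, fun y => ?_⟩
  have h : (e.symm (u y)).toCircle = u y := by
    rw [← AddCircle.homeomorphCircle_apply one_ne_zero]
    exact e.apply_symm_apply _
  have h2 : (u y : ℂ) = f y / ‖f y‖ := rfl
  simp only [ContinuousMap.coe_mk]
  rw [h, h2, mul_div_cancel₀]
  simpa using hf y

/-- A Tietze extension `G` is rescaled by `ρ / max ρ ‖G‖`, a factor equal to 1 on `A`. -/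
theorem exists_extension_norm_le {X : Type*} [TopologicalSpace X] [NormalSpace X] {A : Set X}
    (hA : IsClosed A) (f : C(A, ℂ)) (ρ : C(X, ℝ)) (hρ : ∀ x, 0 < ρ x) (hf : ∀ a, ‖f a‖ ≤ ρ a) :
    ∃ F : C(X, ℂ), (∀ a : A, F a = f a) ∧ ∀ x, ‖F x‖ ≤ ρ x := by
  obtain ⟨G, hG⟩ := ContinuousMap.exists_restrict_eq hA f
  have hG : ∀ a : A, G a = f a := fun a => DFunLike.congr_fun hG a
  have hm : ∀ x, 0 < max (ρ x) ‖G x‖ := fun x => (hρ x).trans_le (le_max_left _ _)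
  refine ⟨⟨fun x => ((ρ x / max (ρ x) ‖G x‖ : ℝ) : ℂ) * G x, ?_⟩, fun a => ?_, fun x => ?_⟩
  · refine Continuous.mul (Complex.continuous_ofReal.comp ?_) G.continuous
    exact ρ.continuous.div (ρ.continuous.max G.continuous.norm) fun x => (hm x).ne'
  · simp only [ContinuousMap.coe_mk]
    rw [hG, max_eq_left (hf a), div_self (hρ a).ne']
    simp
  · simp only [ContinuousMap.coe_mk, norm_mul, Complex.norm_real, Real.norm_eq_abs]
    rw [abs_of_pos (div_pos (hρ x) (hm x)), div_mul_eq_mul_div, div_le_iff₀ (hm x)]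
    exact mul_le_mul_of_nonneg_left (le_max_right _ _) (hρ x).le

/-- The principal argument is continuous on the right half-plane. -/
theorem exists_lift_of_re_pos {Y : Type*} [TopologicalSpace Y] (d : C(Y, UnitAddCircle))
    (hd : ∀ y, 0 < ((d y).toCircle : ℂ).re) :
    ∃ h : C(Y, ℝ), ∀ y, d y = (h y : UnitAddCircle) := by
  refine ⟨⟨fun y => ((d y).toCircle : ℂ).arg / (2 * Real.pi), ?_⟩, fun y => ?_⟩
  · refine Continuous.div_const (continuous_iff_continuousAt.2 fun y => ?_) _
    exact (Complex.continuousAt_arg (Or.inl (hd y))).comp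
      (f := fun y => ((d y).toCircle : ℂ))
      ((continuous_subtype_val.comp AddCircle.continuous_toCircle).comp d.continuous).continuousAt
  · refine AddCircle.injective_toCircle (one_ne_zero (α := ℝ)) ?_
    simp only [ContinuousMap.coe_mk]
    rw [AddCircle.toCircle_apply_mk, div_one, mul_div_cancel₀ _ (by positivity), Circle.exp_arg]

/-- Otherwise `‖z - r‖² = 1 - 2 r Re z + r² ≥ 1`. -/
theorem re_pos_of_norm_sub_lt_one {z : ℂ} (hz : ‖z‖ = 1) {r : ℝ} (hr : 0 ≤ r)
    (h : ‖z - r‖ < 1) : 0 < z.re := by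
  by_contra! hre
  have h1 : ‖z - r‖ ^ 2 < 1 := by
    have := norm_nonneg (z - r)
    nlinarith
  have h2 : ‖z‖ ^ 2 = 1 := by rw [hz, one_pow]
  rw [Complex.sq_norm, Complex.normSq_apply] at h1 h2
  simp only [Complex.sub_re, Complex.sub_im, Complex.ofReal_re, Complex.ofReal_im] at h1
  nlinarith [mul_nonneg hr (neg_nonneg.2 hre), sq_nonneg r]

variable {X : Type u} [TopologicalSpace X] [NormalSpace X] {n : ℕ}

/-- An approximate root `g` with error below 1 has no zero on `A`, so it has a phase `θ` there.
Dividing by the `n`-th power of that phase puts `f - n • θ` within 1 of the nonnegative number `‖g‖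
^ n`, hence in the right half-plane, where it lifts. -/
theorem ApproxRootClosed.exists_nsmul_eq (h : ApproxRootClosed n X) (hn : n ≠ 0) {A : Set X}
    (hA : IsClosed A) (f : C(A, UnitAddCircle)) : ∃ g, n • g = f := by
  let f₀ : C(A, ℂ) := ⟨fun a => ((f a).toCircle : ℂ),
    (continuous_subtype_val.comp AddCircle.continuous_toCircle).comp f.continuous⟩
  obtain ⟨F, hF, hF1⟩ := exists_extension_norm_le hA f₀ 1 (fun _ => one_pos)
    fun a => (Circle.norm_coe _).le
  obtain ⟨g, hg⟩ := h (BoundedContinuousFunction.ofNormedAddCommGroup F F.continuous 1 hF1) 1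
    one_pos
  have hfg : ∀ a : A, ‖((f a).toCircle : ℂ) - g a ^ n‖ < 1 := fun a => by
    refine lt_of_le_of_lt ?_ hg
    have := BoundedContinuousFunction.norm_coe_le_norm
      (BoundedContinuousFunction.ofNormedAddCommGroup F F.continuous 1 hF1 - g ^ n) a
    rw [show ((f a).toCircle : ℂ) = F a from (hF a).symm]
    exact this
  let g₀ : C(A, ℂ) := ⟨fun a => g a, g.continuous.comp continuous_subtype_val⟩
  obtain ⟨θ, hθ⟩ := exists_polar g₀ fun a ha => by
    have h1 := hfg a
    rw [show g a = 0 from ha, zero_pow hn, sub_zero, Circle.norm_coe] at h1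
    exact lt_irrefl _ h1
  obtain ⟨k, hk⟩ := exists_lift_of_re_pos (f - n • θ) fun a => by
    refine re_pos_of_norm_sub_lt_one (Circle.norm_coe _) (pow_nonneg (norm_nonneg (g a)) n) ?_
    have h1 : ((f a).toCircle : ℂ) - g a ^ n =
        ((((f - n • θ) a).toCircle : ℂ) - ((‖g a‖ ^ n : ℝ) : ℂ)) * ((θ a).toCircle : ℂ) ^ n := by
      have h2 : (f a).toCircle = ((f - n • θ) a).toCircle * (θ a).toCircle ^ n := by
        rw [← AddCircle.toCircle_nsmul, ← AddCircle.toCircle_add]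
        simp
      have h3 : g a = ‖g a‖ * ((θ a).toCircle : ℂ) := hθ a
      rw [h2]
      nth_rewrite 1 [h3]
      push_cast
      ring
    have h4 := hfg a
    rwa [h1, norm_mul, norm_pow, Circle.norm_coe, one_pow, mul_one] at h4
  exact exists_nsmul_eq_of_lift hn hk

theorem approxRootClosed_of_exists_nsmul_eq (hn : n ≠ 0)
    (h : ∀ A : Set X, IsClosed A → ∀ f : C(A, UnitAddCircle), ∃ g, n • g = f) :
    ApproxRootClosed n X := by
  intro f ε hε
  have hδ : 0 < ε / 3 := by positivity
  -- Off `A` both `‖f‖` and `‖G‖ ^ n` will be at most `ε / 3`, so the error is at most `2 ε / 3`; on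
  -- `A` it is zero.
  let A : Set X := {x | ε / 3 ≤ ‖f x‖}
  have hA : IsClosed A := isClosed_le continuous_const f.continuous.norm
  let f₀ : C(A, ℂ) := ⟨fun a => f a, f.continuous.comp continuous_subtype_val⟩
  obtain ⟨θ, hθ⟩ := exists_polar f₀ fun a => norm_pos_iff.1 (hδ.trans_le a.2)
  obtain ⟨γ, rfl⟩ := h A hA θ
  have hn' : (0 : ℝ) ≤ (n : ℝ)⁻¹ := by positivity
  have hrpow : Continuous fun t : ℝ => t ^ (n : ℝ)⁻¹ := Real.continuous_rpow_const hn'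
  let r : C(A, ℂ) := ⟨fun a => ((‖f a‖ ^ (n : ℝ)⁻¹ : ℝ) : ℂ) * ((γ a).toCircle : ℂ),
    (Complex.continuous_ofReal.comp (hrpow.comp (f.continuous.norm.comp
      continuous_subtype_val))).mul
      ((continuous_subtype_val.comp AddCircle.continuous_toCircle).comp γ.continuous)⟩
  have hr : ∀ a, r a ^ n = f a := fun a => by
    have h1 : f a = ‖f a‖ * (((n • γ) a).toCircle : ℂ) := hθ a
    change ((‖f a‖ ^ (n : ℝ)⁻¹ : ℝ) * ((γ a).toCircle : ℂ)) ^ n = _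
    rw [mul_pow, ← Complex.ofReal_pow, Real.rpow_inv_natCast_pow (norm_nonneg _) hn]
    conv_rhs => rw [h1]
    rw [ContinuousMap.smul_apply, AddCircle.toCircle_nsmul, Circle.coe_pow]
  -- This bound dominates the root on `A`, equals the `n`-th root of `ε / 3` off `A`, and keeps the
  -- extension bounded.
  let ρ : C(X, ℝ) := ⟨fun x => max ‖f x‖ (ε / 3) ^ (n : ℝ)⁻¹,
    hrpow.comp (f.continuous.norm.max continuous_const)⟩
  obtain ⟨G, hG, hGρ⟩ := exists_extension_norm_le hA r ρ
    (fun x => Real.rpow_pos_of_pos (hδ.trans_le (le_max_right _ _)) _) fun a => by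
      change ‖((‖f a‖ ^ (n : ℝ)⁻¹ : ℝ) : ℂ) * ((γ a).toCircle : ℂ)‖ ≤ _
      rw [norm_mul, Circle.norm_coe, mul_one, Complex.norm_real, Real.norm_of_nonneg (by positivity)]
      exact Real.rpow_le_rpow (norm_nonneg _) (le_max_left _ _) hn'
  refine ⟨BoundedContinuousFunction.ofNormedAddCommGroup G G.continuous
    (max ‖f‖ (ε / 3) ^ (n : ℝ)⁻¹) fun x => (hGρ x).trans (Real.rpow_le_rpow
      (hδ.le.trans (le_max_right _ _)) (max_le_max_right _ (f.norm_coe_le_norm x)) hn'), ?_⟩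
  refine lt_of_le_of_lt ((BoundedContinuousFunction.norm_le (C := 2 * (ε / 3))
    (by positivity)).2 fun x => ?_) (by linarith)
  change ‖f x - G x ^ n‖ ≤ _
  by_cases hx : x ∈ A
  · rw [hG ⟨x, hx⟩, hr, sub_self, norm_zero]
    positivity
  · have hx : ‖f x‖ < ε / 3 := not_le.1 hx
    have h1 : ‖G x‖ ^ n ≤ ε / 3 := by
      refine (pow_le_pow_left₀ (norm_nonneg _) (hGρ x) n).trans ?_
      change (max ‖f x‖ (ε / 3) ^ (n : ℝ)⁻¹) ^ n ≤ _
      rw [max_eq_right hx.le, Real.rpow_inv_natCast_pow hδ.le hn]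
    calc ‖f x - G x ^ n‖ ≤ ‖f x‖ + ‖G x ^ n‖ := norm_sub_le _ _
      _ ≤ 2 * (ε / 3) := by rw [norm_pow]; linarith

end Roots

theorem mainTheorem1 (n : ℕ) (hn : 1 < n) (X : Type u) [TopologicalSpace X] [T2Space X]
    [ParacompactSpace X] :
    ApproxRootClosed n X ↔
      ∀ A : Set X, IsClosed A → IsNDivisible n (CechCohomology A ℤ 1) := by
  have hn0 : n ≠ 0 := by omega
  have key : ∀ A : Set X, IsClosed A → (IsNDivisible n (CechCohomology A ℤ 1) ↔
      ∀ f : C(A, UnitAddCircle), ∃ g, n • g = f) := fun A hA =>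
    -- Paracompactness passes to closed subspaces, so the description of the Čech group applies to
    -- `A`.
    haveI := hA.isClosedEmbedding_subtypeVal.paracompactSpace
    isNDivisible_cech_iff hn0
  exact ⟨fun h A hA => (key A hA).2 (h.exists_nsmul_eq hn0 hA),
    fun h => approxRootClosed_of_exists_nsmul_eq hn0 fun A hA => (key A hA).1 (h A hA)⟩
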